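/- Consider in $\mathbb C^2$ the linear difference system $$\vec u_{n+1}=(I+p_nV_n+R_n)\,\vec u_n,\qquad n\ge 1,$$ and suppose it is non-degenerate, i.e. $\det(I+p_nV_n+R_n)\neq 0$ for every $n\ge 1$. Assume that - $(p_n)_{n\ge1}$ is a sequence of positive real numbers with $p_n\to 0$ and $\sum_{n=1}^\infty p_n=+\infty$; - $(R_n)_{n\ge1}$ is a sequence of complex $2\times 2$ matrices with $\sum_{n=1}^\infty\|R_n\|<\infty$; - $(V_n)_{n\ge1}$ is a sequence of real $2\times2$ matrices with $\sum_{n=1}^\infty\|V_{n+1}-V_n\|<\infty$, whose limit $V:=\lim_{n\to\infty}V_n$ satisfies $\operatorname{discr}V=(\operatorname{tr}V)^2-4\det V\neq0$, i.e. $V$ has two different eigenvalues. Let $\mu_1,\mu_2\in\mathbb C$ be the eigenvalues of $V$, labelled so that $\Re\mu_1\le\Re\mu_2$, and let $\vec x_1,\vec x_2\in\mathbb C^2$ be corresponding eigenvectors. Then the eigenvalues $\mu_1(n),\mu_2(n)$ of $V_n$ (with algebraic multiplicity) can be labelled so that $\mu_1(n)\to\mu_1$ and $\mu_2(n)\to\mu_2$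 as $n\to\infty$, and for every such labelling the space of solutions of the system has a basis $\vec u^{(1)},\vec u^{(2)}$ with $$\vec u^{(i)}_n=\Bigl(\prod_{k=1}^n\bigl[1+p_k\mu_i(k)\bigr]\Bigr)\bigl(\vec x_i+o(1)\bigr),\qquad n\to\infty,\quad i=1,2,$$ where vanishing factors (of which there are only finitely many) are omitted from the product. -/

import Mathlib

open Filter Topology Polynomial

noncomputable section

namespace JanasMoszynski

section Classes

attribute [local instance] Matrix.linftyOpNormedAddCommGroup

/-- The class `l¹` of `2 × 2` matrix sequences: `∑ ‖M n‖ < ∞` (all matrix norms being equivalent,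
the operator norm for the sup norm on vectors is used). -/
def IsL1 {𝕜 : Type*} [RCLike 𝕜] (M : ℕ+ → Matrix (Fin 2) (Fin 2) 𝕜) : Prop :=
  Summable fun n : ℕ+ => ‖M n‖

/-- The class `D¹` (bounded variation) of `2 × 2` matrix sequences: `∑ ‖M (n+1) - M n‖ < ∞`. -/
def IsD1 {𝕜 : Type*} [RCLike 𝕜] (M : ℕ+ → Matrix (Fin 2) (Fin 2) 𝕜) : Prop :=
  Summable fun n : ℕ+ => ‖M (n + 1) - M n‖

end Classes

/-- A real matrix regarded as a complex one. -/
def toComplex (A : Matrix (Fin 2) (Fin 2) ℝ) : Matrix (Fin 2) (Fin 2) ℂ :=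
  A.map fun a : ℝ => (a : ℂ)

/-- The coefficient matrix `I + p n • V n + R n` of the system. -/
def coeff (p : ℕ+ → ℝ) (V : ℕ+ → Matrix (Fin 2) (Fin 2) ℝ)
    (R : ℕ+ → Matrix (Fin 2) (Fin 2) ℂ) (n : ℕ+) : Matrix (Fin 2) (Fin 2) ℂ :=
  1 + (p n : ℂ) • toComplex (V n) + R n

/-- The complex vector space of all solutions `(u n)`, `n ≥ 1`, in `ℂ²`, of the linear difference
system `u (n+1) = A n u n`, `n ≥ 1`. -/
def solutionSpace (A : ℕ+ → Matrix (Fin 2) (Fin 2) ℂ) : Submodule ℂ (ℕ+ → Fin 2 → ℂ) where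
  carrier := {u | ∀ n : ℕ+, u (n + 1) = (A n).mulVec (u n)}
  add_mem' := by
    intro u v hu hv n
    simp only [Pi.add_apply, hu n, hv n, Matrix.mulVec_add]
  zero_mem' := by
    intro n
    simp
  smul_mem' := by
    intro c u hu n
    simp only [Pi.smul_apply, hu n, Matrix.mulVec_smul]

/-- `a 0, a 1` are the two eigenvalues in `ℂ` of the real matrix `A`, listed with algebraic
multiplicity. -/
def AreEigenvalues (A : Matrix (Fin 2) (Fin 2) ℝ) (a : Fin 2 → ℂ) : Prop :=
  (toComplex A).charpoly = (X - C (a 0)) * (X - C (a 1))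

/-- The product `∏_{k=1}^{n} a k` from which vanishing factors are omitted. -/
def nonzeroProd (a : ℕ+ → ℂ) (n : ℕ+) : ℂ :=
  ∏ k ∈ (Finset.Icc 1 n).filter (fun k => a k ≠ 0), a k

end JanasMoszynski

end

/-!
The proof is discrete Levinson theory: a change of variables by eigenvectors turns the system into
a summable perturbation of a diagonal one, which is then solved along each coordinate.

The eigenvalues `ν n 0`, `ν n 1` of `V n` converge to distinct limits, so they inherit bounded
variation from `V n` (`summable_norm_eigenvalue_sub`). Let `X` be the matrix with columns `x 0`,
`x 1`. By the Cayley–Hamilton theorem the `i`-th column of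
`T n = V n * X - X * diagonal (ν n ∘ Fin.rev)` is an eigenvector of `V n` for `ν n i`
(`mul_eigenmatrix`), `T n` has bounded variation and its limit is `X * diagonal (μ i - μ i.rev)`,
which is invertible. Putting `u n = (∏ k < n, (1 + p k ν k i)) • T n w n`, with vanishing factors
omitted, gives `w (n + 1) = M n w n`, where `M n` differs by a summable sequence from the diagonal
matrix with entries `(1 + p n ν n j) / (1 + p n ν n i)`. A solution `w` tending to a multiple of the
`i`-th basis vector is what is needed (`exists_normalized_solution`).

As `V n` is real, the ratios of the diagonal entries obey a dichotomy
(`norm_one_add_mul_dichotomy`). If `Re μ 0 < Re μ 1`, the ratio of the entry for `0` to that for `1`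
has modulus at most `1 - c p n`. If the real parts agree, the eigenvalues are eventually complex
conjugate and the ratio has modulus `1`. There are therefore two cases.
* No other entry is smaller in modulus than the `i`-th one. The backward transfer matrices are
  perturbed contractions fixing the `i`-th basis vector `e`, so the backward evolutions from time
  `n + k` of the value `e` converge as `k → ∞`, and their limits form a solution tending to `e`
  (`exists_backward_solution`, `exists_solution_of_subdominant`).
* The other entries are smaller by factors `1 - c p n`. Forward iteration from a late time keeps the
  `i`-th coordinate near `1`, and it converges; the other ones tend to zero because `∑ p n = ∞`
  (`tendsto_zero_of_le_one_sub_mul_add`, `exists_solution_of_dominant`).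

Non-degeneracy extends these solutions back to the first index, and they are independent because
their normalizations tend to the independent vectors `x 0`, `x 1`.
-/

/-! ### Solutions of summable perturbations of diagonal systems -/

section Levinson

attribute [local instance] Matrix.linftyOpNormedAddCommGroup Matrix.linftyOpNormedRing
  Matrix.linftyOpNormedSpace

/-- A nonnegative sequence contracted by factors `1 - q n` with `∑ q = ∞`, up to a summable
perturbation, tends to zero. -/
theorem tendsto_zero_of_le_one_sub_mul_add {b c q : ℕ → ℝ} (hb : ∀ n, 0 ≤ b n)
    (hc0 : ∀ n, 0 ≤ c n) (hc : Summable c) (hq0 : ∀ n, 0 ≤ q n) (hq : ¬ Summable q)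
    (h : ∀ n, b (n + 1) ≤ (1 - q n) * b n + c n) : Tendsto b atTop (𝓝 0) := by
  have hsum : ∀ n, ∑ k ∈ Finset.range n, c k ≤ ∑' k, c k := fun n =>
    hc.sum_le_tsum _ (fun k _ => hc0 k)
  -- the accumulated perturbation turns `b` into a bounded monotone sequence
  have hanti : Antitone fun n => b n - ∑ k ∈ Finset.range n, c k := by
    refine antitone_nat_of_succ_le fun n => ?_
    rw [Finset.sum_range_succ]
    nlinarith [h n, mul_nonneg (hq0 n) (hb n)]
  have hbdd : BddBelow (Set.range fun n => b n - ∑ k ∈ Finset.range n, c k) := by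
    refine ⟨-∑' k, c k, ?_⟩
    rintro _ ⟨n, rfl⟩
    simp only
    linarith [hb n, hsum n]
  obtain ⟨β, hβ⟩ : ∃ β, Tendsto b atTop (𝓝 β) := by
    refine ⟨_, ((tendsto_atTop_ciInf hanti hbdd).add hc.hasSum.tendsto_sum_nat).congr
      fun n => ?_⟩
    ring
  have hqb : Summable fun n => q n * b n := by
    refine summable_of_sum_range_le (c := b 0 + ∑' k, c k)
      (fun n => mul_nonneg (hq0 n) (hb n)) fun n => ?_
    have : ∑ k ∈ Finset.range n, q k * b k ≤ b 0 - b n + ∑ k ∈ Finset.range n, c k := by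
      induction n with
      | zero => simp
      | succ n ih =>
        rw [Finset.sum_range_succ, Finset.sum_range_succ]
        nlinarith [h n]
    linarith [hb n, hsum n]
  have hβ0 : 0 ≤ β := ge_of_tendsto' hβ hb
  rcases hβ0.eq_or_lt with h0 | h0
  · rwa [h0]
  · refine absurd ?_ hq
    refine summable_of_isBigO_nat hqb (Asymptotics.IsBigO.of_bound (2 / β) ?_)
    filter_upwards [hβ.eventually_const_lt (half_lt_self h0)] with n hn
    rw [Real.norm_of_nonneg (hq0 n), Real.norm_of_nonneg (mul_nonneg (hq0 n) (hb n)),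
      div_mul_eq_mul_div, le_div_iff₀ h0]
    nlinarith [mul_le_mul_of_nonneg_left hn.le (hq0 n)]

theorem prod_range_one_add_le_exp_tsum {s : ℕ → ℝ} (hs0 : ∀ n, 0 ≤ s n) (hs : Summable s)
    (n m : ℕ) : ∏ k ∈ Finset.range m, (1 + s (n + k)) ≤ Real.exp (∑' k, s k) := by
  calc ∏ k ∈ Finset.range m, (1 + s (n + k))
      ≤ ∏ k ∈ Finset.range m, Real.exp (s (n + k)) := by
        refine Finset.prod_le_prod (fun k _ => by linarith [hs0 (n + k)]) fun k _ => ?_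
        linarith [Real.add_one_le_exp (s (n + k))]
    _ = Real.exp (∑ k ∈ Finset.range m, s (n + k)) := (Real.exp_sum _ _).symm
    _ ≤ Real.exp (∑' k, s k) := by
        refine Real.exp_le_exp.2 ?_
        refine le_trans ?_ (hs.sum_le_tsum (Finset.Ico n (n + m)) fun k _ => hs0 k)
        rw [Finset.sum_Ico_eq_sum_range]
        simp

variable {m : Type*} [Fintype m]

/-- A solution on a tail of `ℕ` yields a sequence which is a solution eventually. -/
theorem exists_eventually_solution_of_shift {A : ℕ → Matrix m m ℂ} {e : m → ℂ} (N : ℕ)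
    (h : ∃ z : ℕ → m → ℂ, (∀ n, z (n + 1) = (A (n + N)).mulVec (z n)) ∧ Tendsto z atTop (𝓝 e)) :
    ∃ z : ℕ → m → ℂ, (∀ᶠ n in atTop, z (n + 1) = (A n).mulVec (z n)) ∧
      Tendsto z atTop (𝓝 e) := by
  obtain ⟨z, hz, hlim⟩ := h
  refine ⟨fun n => z (n - N), ?_, hlim.comp (tendsto_sub_atTop_nat N)⟩
  filter_upwards [eventually_ge_atTop N] with n hn
  obtain ⟨k, rfl⟩ := Nat.exists_eq_add_of_le' hn
  have : k + N + 1 - N = k + 1 := by omega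
  simp [this, hz]

variable [DecidableEq m]

/-- The ordered product `B n * B (n + 1) * ⋯ * B (n + k - 1)`. -/
def orderedProd (B : ℕ → Matrix m m ℂ) (n : ℕ) : ℕ → Matrix m m ℂ
  | 0 => 1
  | k + 1 => orderedProd B n k * B (n + k)

theorem orderedProd_succ' (B : ℕ → Matrix m m ℂ) (n k : ℕ) :
    orderedProd B n (k + 1) = B n * orderedProd B (n + 1) k := by
  induction k with
  | zero => simp [orderedProd]
  | succ k ih =>
    rw [orderedProd, ih, orderedProd, Matrix.mul_assoc, Nat.add_right_comm n 1 k, Nat.add_assoc n k]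

theorem norm_orderedProd_mulVec_le {B : ℕ → Matrix m m ℂ} {s : ℕ → ℝ}
    (hs0 : ∀ n, 0 ≤ s n) (hs : Summable s) (hB : ∀ n, ‖B n‖ ≤ 1 + s n) (n k : ℕ) (v : m → ℂ) :
    ‖(orderedProd B n k).mulVec v‖ ≤ Real.exp (∑' k, s k) * ‖v‖ := by
  have h : ‖(orderedProd B n k).mulVec v‖ ≤ (∏ l ∈ Finset.range k, (1 + s (n + l))) * ‖v‖ := by
    induction k generalizing v with
    | zero => simp [orderedProd]
    | succ k ih =>
      rw [orderedProd, ← Matrix.mulVec_mulVec, Finset.prod_range_succ, mul_assoc]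
      refine (ih _).trans ?_
      gcongr
      · exact Finset.prod_nonneg fun l _ => by linarith [hs0 (n + l)]
      · exact (Matrix.linfty_opNorm_mulVec _ _).trans (by gcongr; exact hB _)
  exact h.trans (by gcongr; exact prod_range_one_add_le_exp_tsum hs0 hs n k)

/-- If the backward transfer matrices `B n` are summable perturbations of contractions fixing `e`,
then `lim_k B n B (n+1) ⋯ B (n+k-1) e` exists for each `n`, and gives a solution which converges
to `e`. -/
theorem exists_backward_solution {B : ℕ → Matrix m m ℂ} {s : ℕ → ℝ}
    (hs0 : ∀ n, 0 ≤ s n) (hs : Summable s) (hB : ∀ n, ‖B n‖ ≤ 1 + s n) (e : m → ℂ)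
    (he : ∀ n, ‖(B n).mulVec e - e‖ ≤ s n) :
    ∃ z : ℕ → m → ℂ, (∀ n, z n = (B n).mulVec (z (n + 1))) ∧ Tendsto z atTop (𝓝 e) := by
  set K := Real.exp (∑' k, s k)
  have hd : ∀ n k, dist ((orderedProd B n k).mulVec e) ((orderedProd B n (k + 1)).mulVec e)
      ≤ K * s (k + n) := by
    intro n k
    rw [dist_comm, dist_eq_norm, orderedProd, ← Matrix.mulVec_mulVec, ← Matrix.mulVec_sub,
      add_comm k n]
    exact (norm_orderedProd_mulVec_le hs0 hs hB n k _).trans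
      (mul_le_mul_of_nonneg_left (he _) (Real.exp_pos _).le)
  have hsum : ∀ n, Summable fun k => K * s (k + n) := fun n =>
    ((summable_nat_add_iff n).2 hs).mul_left K
  choose z hz using fun n =>
    cauchySeq_tendsto_of_complete (cauchySeq_of_dist_le_of_summable _ (hd n) (hsum n))
  refine ⟨z, fun n => ?_, ?_⟩
  · refine tendsto_nhds_unique ((hz n).comp (tendsto_add_atTop_nat 1)) ?_
    have hcont : Continuous fun v : m → ℂ => (B n).mulVec v := by fun_prop
    refine ((hcont.tendsto _).comp (hz (n + 1))).congr fun k => ?_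
    simp [orderedProd_succ']
  · rw [tendsto_iff_dist_tendsto_zero]
    have h0 : Tendsto (fun n => ∑' k, K * s (k + n)) atTop (𝓝 0) := by
      simp_rw [tsum_mul_left]
      simpa using (tendsto_sum_nat_add s).const_mul K
    refine squeeze_zero (fun _ => dist_nonneg) (fun n => ?_) h0
    rw [dist_comm]
    simpa [orderedProd] using dist_le_tsum_of_dist_le_of_tendsto₀ _ (hd n) (hsum n) (hz n)

theorem norm_mulVec_sub_diagonal_apply_le (M : Matrix m m ℂ) (d v : m → ℂ) (i : m) :
    ‖M.mulVec v i - d i * v i‖ ≤ ‖M - Matrix.diagonal d‖ * ‖v‖ := by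
  refine le_trans ?_ (Matrix.linfty_opNorm_mulVec _ _)
  refine le_trans (le_of_eq ?_) (norm_le_pi_norm _ i)
  rw [Matrix.sub_mulVec, Pi.sub_apply, Matrix.mulVec_diagonal]

theorem norm_diagonal_le_one {d : m → ℂ} (hd : ∀ i, ‖d i‖ ≤ 1) : ‖Matrix.diagonal d‖ ≤ 1 := by
  rw [Matrix.linfty_opNorm_diagonal]
  exact (pi_norm_le_iff_of_nonneg zero_le_one).2 hd

theorem norm_single_one_le (i : m) : ‖(Pi.single i 1 : m → ℂ)‖ ≤ 1 := by
  refine (pi_norm_le_iff_of_nonneg zero_le_one).2 fun j => ?_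
  by_cases h : j = i
  · subst h
    simp
  · simp [h]

/-- Forward iteration of a small summable perturbation of diagonal contractions, which fix the
coordinate `i` and contract the coordinates `j ≠ i` by `1 - q n` with `∑ q = ∞`. -/
theorem exists_forward_solution_of_small {M : ℕ → Matrix m m ℂ} {d : ℕ → m → ℂ} {q : ℕ → ℝ}
    (hs : Summable fun n => ‖M n - Matrix.diagonal (d n)‖)
    (hsmall : Real.exp (∑' n, ‖M n - Matrix.diagonal (d n)‖) *
      ∑' n, ‖M n - Matrix.diagonal (d n)‖ < 1)
    {i : m} (hi : ∀ n, d n i = 1) (hq0 : ∀ n, 0 ≤ q n) (hq : ¬ Summable q)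
    (hj : ∀ n, ∀ j ≠ i, ‖d n j‖ ≤ 1 - q n) :
    ∃ z : ℕ → m → ℂ, (∀ n, z (n + 1) = (M n).mulVec (z n)) ∧
      Tendsto z atTop (𝓝 (Pi.single i 1)) := by
  set s := fun n => ‖M n - Matrix.diagonal (d n)‖
  have hs0 : ∀ n, 0 ≤ s n := fun n => norm_nonneg _
  set K := Real.exp (∑' k, s k)
  let z : ℕ → m → ℂ := fun n => Nat.rec (Pi.single i 1) (fun n v => (M n).mulVec v) n
  have hz0 : z 0 = Pi.single i 1 := rfl
  have hz : ∀ n, z (n + 1) = (M n).mulVec (z n) := fun n => rfl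
  have hd1 : ∀ n j, ‖d n j‖ ≤ 1 := by
    intro n j
    by_cases h : j = i
    · simp [h, hi]
    · linarith [hj n j h, hq0 n]
  have hM : ∀ n, ‖M n‖ ≤ 1 + s n := fun n => by
    calc ‖M n‖ = ‖Matrix.diagonal (d n) + (M n - Matrix.diagonal (d n))‖ := by simp
      _ ≤ _ := (norm_add_le _ _).trans (by gcongr; exact norm_diagonal_le_one (hd1 n))
  have hbound : ∀ n, ‖z n‖ ≤ K := by
    intro n
    have : ‖z n‖ ≤ ∏ k ∈ Finset.range n, (1 + s (0 + k)) := by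
      induction n with
      | zero => simpa [hz0] using norm_single_one_le i
      | succ n ih =>
        rw [Finset.prod_range_succ, hz, mul_comm, zero_add]
        refine (Matrix.linfty_opNorm_mulVec _ _).trans ?_
        gcongr
        exact hM n
    exact this.trans (prod_range_one_add_le_exp_tsum hs0 hs 0 n)
  have hstep : ∀ n j, ‖z (n + 1) j - d n j * z n j‖ ≤ K * s n := by
    intro n j
    rw [hz]
    refine (norm_mulVec_sub_diagonal_apply_le _ _ _ _).trans ?_
    rw [mul_comm]
    exact mul_le_mul_of_nonneg_right (hbound n) (hs0 n)
  have hKs : Summable fun n => K * s n := hs.mul_left K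
  have hdist : ∀ n, dist (z n i) (z (n + 1) i) ≤ K * s n := fun n => by
    rw [dist_comm, dist_eq_norm]
    simpa [hi] using hstep n i
  obtain ⟨a, ha⟩ := cauchySeq_tendsto_of_complete
    (cauchySeq_of_dist_le_of_summable _ hdist hKs)
  -- the total drift of the coordinate `i`, which starts at `1`, is less than `1`
  have ha0 : a ≠ 0 := by
    rintro rfl
    have := dist_le_tsum_of_dist_le_of_tendsto₀ _ hdist hKs ha
    rw [hz0, tsum_mul_left] at this
    simp only [Pi.single_eq_same, dist_zero_right, norm_one] at this
    linarith
  have hzj : ∀ j ≠ i, Tendsto (fun n => z n j) atTop (𝓝 0) := by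
    intro j hji
    rw [tendsto_zero_iff_norm_tendsto_zero]
    refine tendsto_zero_of_le_one_sub_mul_add (c := fun n => K * s n) (fun _ => norm_nonneg _)
      (fun n => mul_nonneg (Real.exp_pos _).le (hs0 n)) hKs hq0 hq fun n => ?_
    calc ‖z (n + 1) j‖ = ‖d n j * z n j + (z (n + 1) j - d n j * z n j)‖ := by simp
      _ ≤ ‖d n j‖ * ‖z n j‖ + K * s n := by
        refine (norm_add_le _ _).trans ?_
        rw [norm_mul]
        gcongr
        exact hstep n j
      _ ≤ _ := by gcongr; exact hj n j hji
  refine ⟨fun n => a⁻¹ • z n, fun n => by simp [hz, Matrix.mulVec_smul], ?_⟩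
  rw [tendsto_pi_nhds]
  intro j
  by_cases h : j = i
  · subst h
    simpa [ha0] using ha.const_mul a⁻¹
  · simpa [h] using (hzj j h).const_mul a⁻¹

/-- The Levinson theorem for a solution along a dominant coordinate `i`. -/
theorem exists_solution_of_dominant {M : ℕ → Matrix m m ℂ} {d : ℕ → m → ℂ} {q : ℕ → ℝ}
    (hs : Summable fun n => ‖M n - Matrix.diagonal (d n)‖)
    {i : m} (hi : ∀ᶠ n in atTop, d n i = 1) (hq0 : ∀ n, 0 ≤ q n) (hq : ¬ Summable q)
    (hj : ∀ᶠ n in atTop, ∀ j ≠ i, ‖d n j‖ ≤ 1 - q n) :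
    ∃ z : ℕ → m → ℂ, (∀ᶠ n in atTop, z (n + 1) = (M n).mulVec (z n)) ∧
      Tendsto z atTop (𝓝 (Pi.single i 1)) := by
  have htail := tendsto_sum_nat_add fun n => ‖M n - Matrix.diagonal (d n)‖
  have hlim := ((Real.continuous_exp.tendsto 0).comp htail).mul htail
  rw [mul_zero] at hlim
  obtain ⟨N, hN⟩ := eventually_atTop.1
    ((hi.and hj).and (eventually_forall_ge_atTop.2 (hlim.eventually_lt_const zero_lt_one)))
  refine exists_eventually_solution_of_shift N
    (exists_forward_solution_of_small (d := fun n => d (n + N)) (q := fun n => q (n + N))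
      ((summable_nat_add_iff N).2 hs) ((hN N le_rfl).2 N le_rfl)
      (fun n => (hN _ (Nat.le_add_left N n)).1.1) (fun n => hq0 _)
      (fun h => hq ((summable_nat_add_iff N).1 h))
      (fun n => (hN _ (Nat.le_add_left N n)).1.2))

/-- The Levinson theorem for a solution along a coordinate `i` which no other coordinate
decays against: the inverse transfer matrices are perturbed contractions. -/
theorem exists_solution_of_subdominant {M : ℕ → Matrix m m ℂ} {d : ℕ → m → ℂ}
    (hs : Summable fun n => ‖M n - Matrix.diagonal (d n)‖)
    (hdet : ∀ᶠ n in atTop, (M n).det ≠ 0)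
    (hinv : (fun n => (M n)⁻¹) =O[atTop] fun _ => (1 : ℝ))
    {i : m} (hi : ∀ᶠ n in atTop, d n i = 1) (hj : ∀ᶠ n in atTop, ∀ j, 1 ≤ ‖d n j‖) :
    ∃ z : ℕ → m → ℂ, (∀ᶠ n in atTop, z (n + 1) = (M n).mulVec (z n)) ∧
      Tendsto z atTop (𝓝 (Pi.single i 1)) := by
  have hdd : ∀ n, (∀ j, 1 ≤ ‖d n j‖) → ∀ j, d n j ≠ 0 := fun n h j h0 => by
    have := h j
    rw [h0, norm_zero] at this
    linarith
  have hD1 : ∀ n, (∀ j, 1 ≤ ‖d n j‖) → ‖Matrix.diagonal fun j => (d n j)⁻¹‖ ≤ 1 := fun n h =>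
    norm_diagonal_le_one fun j => by
      rw [norm_inv]
      exact inv_le_one_of_one_le₀ (h j)
  -- `M⁻¹ - D⁻¹ = -M⁻¹ (M - D) D⁻¹` with bounded outer factors
  have hdiff : (fun n => (M n)⁻¹ - Matrix.diagonal fun j => (d n j)⁻¹) =O[atTop]
      fun n => ‖M n - Matrix.diagonal (d n)‖ := by
    have hDO : (fun n => Matrix.diagonal fun j => (d n j)⁻¹) =O[atTop] fun _ => (1 : ℝ) := by
      refine Asymptotics.IsBigO.of_bound 1 ?_
      filter_upwards [hj] with n hn
      simpa using hD1 n hn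
    have h := (hinv.mul (Asymptotics.isBigO_norm_right.2 (Asymptotics.isBigO_refl
      (fun n => M n - Matrix.diagonal (d n)) atTop))).mul hDO
    simp only [one_mul, mul_one] at h
    refine h.neg_left.congr' ?_ EventuallyEq.rfl
    filter_upwards [hdet, hj] with n hn hjn
    have h1 : (M n)⁻¹ * M n = 1 := Matrix.nonsing_inv_mul _ (Ne.isUnit hn)
    have h2 : Matrix.diagonal (d n) * (Matrix.diagonal fun j => (d n j)⁻¹) = 1 := by
      rw [Matrix.diagonal_mul_diagonal, ← Matrix.diagonal_one]
      congr 1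
      ext j
      exact mul_inv_cancel₀ (hdd n hjn j)
    rw [mul_sub, sub_mul, h1, mul_assoc _ (Matrix.diagonal (d n)), h2]
    simp
  set s := fun n => ‖(M n)⁻¹ - Matrix.diagonal fun j => (d n j)⁻¹‖
  have hs' : Summable s := by
    exact summable_of_isBigO_nat hs hdiff.norm_left
  obtain ⟨N, hN⟩ := eventually_atTop.1 ((hdet.and hi).and hj)
  have hN' : ∀ n, ((M (n + N)).det ≠ 0 ∧ d (n + N) i = 1) ∧ ∀ j, 1 ≤ ‖d (n + N) j‖ :=
    fun n => hN _ (Nat.le_add_left N n)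
  refine exists_eventually_solution_of_shift N ?_
  obtain ⟨z, hz, hlim⟩ := exists_backward_solution (B := fun n => (M (n + N))⁻¹)
    (s := fun n => s (n + N)) (fun n => norm_nonneg _) ((summable_nat_add_iff N).2 hs')
    (fun n => by
      calc ‖(M (n + N))⁻¹‖ = ‖(Matrix.diagonal fun j => (d (n + N) j)⁻¹) +
            ((M (n + N))⁻¹ - Matrix.diagonal fun j => (d (n + N) j)⁻¹)‖ := by simp
        _ ≤ _ := (norm_add_le _ _).trans (by gcongr; exact hD1 _ (hN' n).2))
    (Pi.single i 1)
    (fun n => by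
      have h1 : (Matrix.diagonal fun j => (d (n + N) j)⁻¹).mulVec (Pi.single i 1)
          = Pi.single i 1 := by
        ext j
        rw [Matrix.mulVec_diagonal]
        by_cases h : j = i
        · subst h
          simp [(hN' n).1.2]
        · simp [h]
      calc _ = ‖((M (n + N))⁻¹ - Matrix.diagonal fun j => (d (n + N) j)⁻¹).mulVec
            (Pi.single i 1)‖ := by rw [Matrix.sub_mulVec, h1]
        _ ≤ _ := (Matrix.linfty_opNorm_mulVec _ _).trans
            (mul_le_of_le_one_right (norm_nonneg _) (norm_single_one_le i)))
  refine ⟨z, fun n => ?_, hlim⟩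
  rw [hz n, Matrix.mulVec_mulVec, Matrix.mul_nonsing_inv _ (Ne.isUnit (hN' n).1.1),
    Matrix.one_mulVec]

/-- A sequence which solves an invertible system eventually coincides eventually with a genuine
solution. -/
theorem exists_solution_of_eventually {A : ℕ → Matrix m m ℂ} (hA : ∀ n, (A n).det ≠ 0)
    {e : m → ℂ}
    (h : ∃ z : ℕ → m → ℂ, (∀ᶠ n in atTop, z (n + 1) = (A n).mulVec (z n)) ∧
      Tendsto z atTop (𝓝 e)) :
    ∃ z : ℕ → m → ℂ, (∀ n, z (n + 1) = (A n).mulVec (z n)) ∧ Tendsto z atTop (𝓝 e) := by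
  obtain ⟨z, hz, hlim⟩ := h
  obtain ⟨N, hN⟩ := eventually_atTop.1 hz
  -- it suffices to continue backwards one step at a time
  have key : ∀ k ≤ N, ∃ w : ℕ → m → ℂ,
      (∀ n, N - k ≤ n → w (n + 1) = (A n).mulVec (w n)) ∧ Tendsto w atTop (𝓝 e) := by
    intro k
    induction k with
    | zero => exact fun _ => ⟨z, hN, hlim⟩
    | succ k ih =>
      intro hk
      obtain ⟨w, hw, hwlim⟩ := ih (by omega)
      set a := N - (k + 1) with ha
      have ha1 : N - k = a + 1 := by omega
      rw [ha1] at hw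
      refine ⟨Function.update w a ((A a)⁻¹.mulVec (w (a + 1))), fun n hn => ?_, ?_⟩
      · rcases hn.eq_or_lt with rfl | hlt
        · rw [Function.update_self, Function.update_of_ne (by omega), Matrix.mulVec_mulVec,
            Matrix.mul_nonsing_inv _ (Ne.isUnit (hA _)), Matrix.one_mulVec]
        · rw [Function.update_of_ne (by omega), Function.update_of_ne (by omega)]
          exact hw n hlt
      · refine hwlim.congr' ?_
        filter_upwards [eventually_gt_atTop a] with n hn
        rw [Function.update_of_ne (by omega)]
  obtain ⟨w, hw, hwlim⟩ := key N le_rfl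
  exact ⟨w, fun n => hw n (by simp), hwlim⟩

end Levinson

/-! ### Diagonalisation by eigenvectors of bounded variation -/

section Diagonalisation

attribute [local instance] Matrix.linftyOpNormedAddCommGroup Matrix.linftyOpNormedRing
  Matrix.linftyOpNormedSpace Matrix.linftyOpNormedAlgebra

theorem tendsto_matrix_inv {m : Type*} [Fintype m] [DecidableEq m] {T : ℕ → Matrix m m ℂ}
    {T₀ : Matrix m m ℂ} (hT : Tendsto T atTop (𝓝 T₀)) (h : T₀.det ≠ 0) :
    Tendsto (fun n => (T n)⁻¹) atTop (𝓝 T₀⁻¹) := by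
  simp only [Matrix.inv_def, Ring.inverse_eq_inv']
  have h1 : Tendsto (fun n => (T n).det) atTop (𝓝 T₀.det) :=
    ((continuous_id.matrix_det).tendsto T₀).comp hT
  have h2 : Tendsto (fun n => (T n).adjugate) atTop (𝓝 T₀.adjugate) :=
    ((continuous_id.matrix_adjugate).tendsto T₀).comp hT
  exact (h1.inv₀ h).smul h2

theorem norm_matrix_apply_le {m : Type*} [Fintype m] (A : Matrix m m ℂ) (k l : m) :
    ‖A k l‖ ≤ ‖A‖ := by
  rw [Matrix.linfty_opNorm_def, ← coe_nnnorm, NNReal.coe_le_coe]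
  exact (Finset.single_le_sum (f := fun l => ‖A k l‖₊) (fun _ _ => bot_le)
    (Finset.mem_univ l)).trans (Finset.le_sup (f := fun k => ∑ l, ‖A k l‖₊) (Finset.mem_univ k))

/-- Separated eigenvalues of a sequence of `2 × 2` matrices of bounded variation are of bounded
variation: the characteristic polynomial of `V n` at the eigenvalue `ν (n + 1) i` of `V (n + 1)`
is `O(‖V (n + 1) - V n‖)`. -/
theorem summable_norm_eigenvalue_sub {V : ℕ → Matrix (Fin 2) (Fin 2) ℂ}
    {V₀ : Matrix (Fin 2) (Fin 2) ℂ} {ν : ℕ → Fin 2 → ℂ} {μ : Fin 2 → ℂ}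
    (hVlim : Tendsto V atTop (𝓝 V₀)) (hV : Summable fun n => ‖V (n + 1) - V n‖)
    (htr : ∀ n i, ν n i + ν n i.rev = (V n).trace) (hdet : ∀ n i, ν n i * ν n i.rev = (V n).det)
    (hν : Tendsto ν atTop (𝓝 μ)) (hμ : ∀ i, μ i ≠ μ i.rev) (i : Fin 2) :
    Summable fun n => ‖ν (n + 1) i - ν n i‖ := by
  have hVO : ∀ k l, (fun n => V n k l) =O[atTop] fun _ => (1 : ℝ) := fun k l =>
    ((((continuous_id.matrix_elem k l).tendsto V₀).comp hVlim).isBigO_one ℝ)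
  have hVO' : ∀ k l, (fun n => V (n + 1) k l) =O[atTop] fun _ => (1 : ℝ) := fun k l =>
    (hVO k l).comp_tendsto (tendsto_add_atTop_nat 1)
  have hdiff : ∀ k l, (fun n => V (n + 1) k l - V n k l) =O[atTop]
      fun n => ‖V (n + 1) - V n‖ := fun k l =>
    Asymptotics.isBigO_of_le _ fun n => by
      simpa using norm_matrix_apply_le (V (n + 1) - V n) k l
  have htrO : (fun n => (V (n + 1)).trace - (V n).trace) =O[atTop]
      fun n => ‖V (n + 1) - V n‖ := by
    refine ((hdiff 0 0).add (hdiff 1 1)).congr_left fun n => ?_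
    simp only [Matrix.trace_fin_two]
    ring
  have hprod : ∀ k l k' l', (fun n => V (n + 1) k l * V (n + 1) k' l' - V n k l * V n k' l')
      =O[atTop] fun n => ‖V (n + 1) - V n‖ := fun k l k' l' => by
    have h := ((hdiff k l).mul (hVO' k' l')).add
      (((hdiff k' l').mul (hVO k l)))
    simp only [mul_one] at h
    refine h.congr_left fun n => ?_
    ring
  have hdetO : (fun n => (V (n + 1)).det - (V n).det) =O[atTop]
      fun n => ‖V (n + 1) - V n‖ := by
    refine ((hprod 0 0 1 1).sub (hprod 0 1 1 0)).congr_left fun n => ?_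
    simp only [Matrix.det_fin_two]
    ring
  have hνi : ∀ i, Tendsto (fun n => ν n i) atTop (𝓝 (μ i)) := tendsto_pi_nhds.1 hν
  have hν' : Tendsto (fun n => ν (n + 1) i) atTop (𝓝 (μ i)) :=
    (hνi i).comp (tendsto_add_atTop_nat 1)
  have hsub := hν'.sub (hνi i.rev)
  have hsub0 : μ i - μ i.rev ≠ 0 := sub_ne_zero.2 (hμ i)
  have hchar := ((htrO.mul (hν'.isBigO_one ℝ)).sub
    (g := fun n => ‖V (n + 1) - V n‖ * 1) (by simpa using hdetO)).mul
      ((hsub.inv₀ hsub0).isBigO_one ℝ)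
  simp only [mul_one] at hchar
  refine summable_of_isBigO_nat hV (hchar.congr' ?_ EventuallyEq.rfl).norm_left
  filter_upwards [hsub.eventually_ne hsub0] with n hn
  rw [mul_inv_eq_iff_eq_mul₀ hn, ← htr (n + 1) i, ← htr n i, ← hdet (n + 1) i, ← hdet n i]
  ring

/-- Columns of `V * X - X * N'` are eigenvectors of `V`: if `N`, `N'` are diagonal matrices of the
two eigenvalues in either order, this is the Cayley–Hamilton theorem. -/
theorem mul_eigenmatrix {V X : Matrix (Fin 2) (Fin 2) ℂ} {ν : Fin 2 → ℂ}
    (htr : ∀ i, ν i + ν i.rev = V.trace) (hdet : ∀ i, ν i * ν i.rev = V.det) :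
    V * (V * X - X * Matrix.diagonal fun i => ν i.rev) =
      (V * X - X * Matrix.diagonal fun i => ν i.rev) * Matrix.diagonal ν := by
  have ht := htr 0
  have hd := hdet 0
  rw [Matrix.trace_fin_two] at ht
  rw [Matrix.det_fin_two] at hd
  have e1 : Fin.rev (0 : Fin 2) = 1 := rfl
  have e2 : Fin.rev (1 : Fin 2) = 0 := rfl
  rw [e1] at ht hd
  ext k l
  fin_cases k <;> fin_cases l <;>
    simp [Matrix.mul_apply, Fin.sum_univ_two, Matrix.diagonal_apply, e1, e2]
  · linear_combination (V 0 0 * X 0 0 + V 0 1 * X 1 0) * -ht + X 0 0 * hd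
  · linear_combination (V 0 0 * X 0 1 + V 0 1 * X 1 1) * -ht + X 0 1 * hd
  · linear_combination (V 1 0 * X 0 0 + V 1 1 * X 1 0) * -ht + X 1 0 * hd
  · linear_combination (V 1 0 * X 0 1 + V 1 1 * X 1 1) * -ht + X 1 1 * hd

theorem det_of_eigenvectors_ne_zero {A : Matrix (Fin 2) (Fin 2) ℂ} {μ : Fin 2 → ℂ}
    (hμ : μ 0 ≠ μ 1) {x : Fin 2 → Fin 2 → ℂ}
    (hx : ∀ i, Module.End.HasEigenvector (Matrix.toLin' A) (μ i) (x i)) :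
    (Matrix.of x).det ≠ 0 := by
  have hinj : Function.Injective μ := by
    intro i j h
    fin_cases i <;> fin_cases j <;> simp_all
  have h := Module.End.eigenvectors_linearIndependent' _ μ hinj x hx
  exact (Matrix.isUnit_iff_isUnit_det _).1
    (Matrix.linearIndependent_rows_iff_isUnit.1
      (show LinearIndependent ℂ (Matrix.of x).row from h)) |>.ne_zero

/-- After the change of variables by the eigenvector matrices of `V n` the system is a summable
perturbation of a diagonal one, and Levinson's theorem gives a solution along the `i`-th
eigenvector, provided that the `i`-th diagonal entry either is dominated by the other one or
dominates it strictly enough. -/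
theorem exists_normalized_solution {p : ℕ → ℝ} {V R : ℕ → Matrix (Fin 2) (Fin 2) ℂ}
    {V₀ : Matrix (Fin 2) (Fin 2) ℂ} {ν : ℕ → Fin 2 → ℂ} {μ : Fin 2 → ℂ}
    {x : Fin 2 → Fin 2 → ℂ} {γ : ℕ → ℂ} {i : Fin 2}
    (hp0 : ∀ n, 0 ≤ p n) (hp : Tendsto p atTop (𝓝 0)) (hpsum : ¬ Summable p)
    (hR : Summable fun n => ‖R n‖)
    (hVlim : Tendsto V atTop (𝓝 V₀)) (hV : Summable fun n => ‖V (n + 1) - V n‖)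
    (htr : ∀ n i, ν n i + ν n i.rev = (V n).trace) (hdet : ∀ n i, ν n i * ν n i.rev = (V n).det)
    (hν : Tendsto ν atTop (𝓝 μ)) (hμ : μ 0 ≠ μ 1)
    (hx : ∀ i, Module.End.HasEigenvector (Matrix.toLin' V₀) (μ i) (x i))
    (hA : ∀ n, (1 + (p n : ℂ) • V n + R n).det ≠ 0)
    (hγ0 : ∀ n, γ n ≠ 0) (hγ : ∀ᶠ n in atTop, γ n = 1 + p n * ν n i)
    (hratio : (∀ᶠ n in atTop, ∀ j, ‖1 + p n * ν n i‖ ≤ ‖1 + p n * ν n j‖) ∨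
      ∃ c > 0, ∀ᶠ n in atTop, ∀ j ≠ i,
        ‖1 + p n * ν n j‖ ≤ (1 - c * p n) * ‖1 + p n * ν n i‖) :
    ∃ z : ℕ → Fin 2 → ℂ,
      (∀ n, z (n + 1) = ((γ n)⁻¹ • (1 + (p n : ℂ) • V n + R n)).mulVec (z n)) ∧
      Tendsto z atTop (𝓝 (x i)) := by
  have hμ' : ∀ i, μ i ≠ μ i.rev := by
    intro i
    fin_cases i
    · exact hμ
    · exact hμ.symm
  set A : ℕ → Matrix (Fin 2) (Fin 2) ℂ := fun n => 1 + (p n : ℂ) • V n + R n with hAdef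
  set X : Matrix (Fin 2) (Fin 2) ℂ := (Matrix.of x).transpose with hX
  set T : ℕ → Matrix (Fin 2) (Fin 2) ℂ := fun n =>
    V n * X - X * Matrix.diagonal fun i => ν n i.rev with hT
  set T₀ : Matrix (Fin 2) (Fin 2) ℂ := X * Matrix.diagonal fun i => μ i - μ i.rev with hT₀
  have hνi : ∀ i, Tendsto (fun n => ν n i) atTop (𝓝 (μ i)) := tendsto_pi_nhds.1 hν
  have hVX : V₀ * X = X * Matrix.diagonal μ := by
    ext k l
    have h := congrFun (hx l).apply_eq_smul k
    rw [Matrix.toLin'_apply] at h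
    rw [Matrix.mul_diagonal, mul_comm]
    exact h
  have hdiag : Continuous fun d : Fin 2 → ℂ => Matrix.diagonal d := by fun_prop
  have hTlim : Tendsto T atTop (𝓝 T₀) := by
    have h1 : Tendsto (fun n => Matrix.diagonal fun i : Fin 2 => ν n i.rev) atTop
        (𝓝 (Matrix.diagonal fun i => μ i.rev)) :=
      (hdiag.tendsto _).comp (tendsto_pi_nhds.2 fun i => hνi i.rev)
    have h2 := (hVlim.mul_const X).sub (h1.const_mul X)
    rwa [hVX, ← mul_sub, Matrix.diagonal_sub] at h2
  have hT₀det : T₀.det ≠ 0 := by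
    rw [hT₀, Matrix.det_mul, Matrix.det_diagonal, hX, Matrix.det_transpose]
    exact mul_ne_zero (det_of_eigenvectors_ne_zero hμ hx)
      (Finset.prod_ne_zero_iff.2 fun i _ => sub_ne_zero.2 (hμ' i))
  have hT'lim : Tendsto (fun n => T (n + 1)) atTop (𝓝 T₀) := hTlim.comp (tendsto_add_atTop_nat 1)
  have hTinv : Tendsto (fun n => (T (n + 1))⁻¹) atTop (𝓝 T₀⁻¹) := tendsto_matrix_inv hT'lim hT₀det
  have hTdet : ∀ᶠ n in atTop, (T (n + 1)).det ≠ 0 :=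
    (((continuous_id.matrix_det).tendsto T₀).comp hT'lim).eventually_ne hT₀det
  -- bounded variation of the eigenvector matrices
  have hTsum : Summable fun n => ‖T n - T (n + 1)‖ := by
    have hνs := fun i => summable_norm_eigenvalue_sub hVlim hV htr hdet hν hμ' i
    have hs := (hV.mul_right ‖X‖).add (((hνs 0).add (hνs 1)).mul_left ‖X‖)
    refine Summable.of_nonneg_of_le (fun _ => norm_nonneg _) (fun n => ?_) hs
    have e : T n - T (n + 1) = X * (Matrix.diagonal fun i => ν (n + 1) i.rev - ν n i.rev) -
        (V (n + 1) - V n) * X := by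
      simp only [hT]
      rw [← Matrix.diagonal_sub, mul_sub, sub_mul]
      abel
    rw [e]
    refine (norm_sub_le _ _).trans ?_
    rw [add_comm]
    refine add_le_add (norm_mul_le _ _) ((norm_mul_le _ _).trans ?_)
    gcongr
    rw [Matrix.linfty_opNorm_diagonal]
    refine (pi_norm_le_iff_of_nonneg (by positivity)).2 fun i => ?_
    fin_cases i
    · simp [Fin.rev]
    · simp [Fin.rev]
  have hpC : Tendsto (fun n => (p n : ℂ)) atTop (𝓝 0) := by
    exact_mod_cast (Complex.continuous_ofReal.tendsto 0).comp hp
  set Λ : ℕ → Fin 2 → ℂ := fun n j => 1 + p n * ν n j with hΛ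
  have hΛlim : ∀ j, Tendsto (fun n => Λ n j) atTop (𝓝 1) := fun j => by
    simpa using (hpC.mul (hνi j)).const_add 1
  have hγlim : Tendsto γ atTop (𝓝 1) := (hΛlim i).congr' (hγ.mono fun n hn => hn.symm)
  have hγinv : Tendsto (fun n => (γ n)⁻¹) atTop (𝓝 1) := by
    simpa using hγlim.inv₀ one_ne_zero
  have hDlim : Tendsto (fun n => Matrix.diagonal (Λ n)) atTop (𝓝 (Matrix.diagonal fun _ => 1)) :=
    (hdiag.tendsto _).comp (tendsto_pi_nhds.2 hΛlim)
  have hRlim : Tendsto R atTop (𝓝 0) :=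
    tendsto_zero_iff_norm_tendsto_zero.2 hR.tendsto_atTop_zero
  have hAlim : Tendsto A atTop (𝓝 1) := by
    have h := ((hpC.smul hVlim).const_add 1).add hRlim
    rwa [zero_smul, add_zero, add_zero] at h
  set M : ℕ → Matrix (Fin 2) (Fin 2) ℂ := fun n => (γ n)⁻¹ • ((T (n + 1))⁻¹ * A n * T n) with hM
  set d : ℕ → Fin 2 → ℂ := fun n j => (γ n)⁻¹ * Λ n j with hd
  have hMlim : Tendsto M atTop (𝓝 1) := by
    have h := hγinv.smul ((hTinv.mul hAlim).mul hTlim)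
    rwa [mul_one, Matrix.nonsing_inv_mul _ (Ne.isUnit hT₀det), one_smul] at h
  -- `M n - diagonal (d n)` is the contribution of `T n - T (n + 1)` and of `R n`, the other factors
  -- being bounded
  have hs : Summable fun n => ‖M n - Matrix.diagonal (d n)‖ := by
    have hO : (fun n => (γ n)⁻¹ • ((T (n + 1))⁻¹ * (T n - T (n + 1)) * Matrix.diagonal (Λ n) +
        (T (n + 1))⁻¹ * R n * T n)) =O[atTop] fun n => ‖T n - T (n + 1)‖ + ‖R n‖ := by
      have g1 : (fun n => T n - T (n + 1)) =O[atTop] fun n => ‖T n - T (n + 1)‖ + ‖R n‖ :=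
        Asymptotics.isBigO_of_le _ fun n => by
          rw [Real.norm_of_nonneg (by positivity)]
          linarith [norm_nonneg (R n)]
      have g2 : R =O[atTop] fun n => ‖T n - T (n + 1)‖ + ‖R n‖ :=
        Asymptotics.isBigO_of_le _ fun n => by
          rw [Real.norm_of_nonneg (by positivity)]
          linarith [norm_nonneg (T n - T (n + 1))]
      have o := hTinv.isBigO_one ℝ
      have := (hγinv.isBigO_one ℝ).smul
        (((o.mul g1).mul (hDlim.isBigO_one ℝ)).add
          ((((o.mul g2).mul (hTlim.isBigO_one ℝ)))))
      simpa only [one_mul, mul_one, one_smul] using this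
    have hsum := hTsum.add hR
    refine summable_of_isBigO_nat hsum ((hO.congr' ?_ EventuallyEq.rfl).norm_left)
    filter_upwards [hTdet] with n hn
    have h1 : (T (n + 1))⁻¹ * T (n + 1) = 1 := Matrix.nonsing_inv_mul _ (Ne.isUnit hn)
    have h2 : Matrix.diagonal (d n) = (γ n)⁻¹ • Matrix.diagonal (Λ n) := by
      ext k l
      simp [hd, Matrix.diagonal_apply]
    have h3 : A n * T n = T n * Matrix.diagonal (Λ n) + R n * T n := by
      have h4 : Matrix.diagonal (Λ n) = 1 + (p n : ℂ) • Matrix.diagonal (ν n) := by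
        ext k l
        by_cases hkl : k = l <;> simp [hΛ, hkl]
      rw [h4, mul_add, mul_one, mul_smul_comm, ← mul_eigenmatrix (htr n) (hdet n)]
      simp only [hAdef, add_mul, one_mul, smul_mul_assoc]
      rfl
    simp only [hM]
    rw [h2, ← smul_sub, mul_assoc _ (A n), h3, mul_sub, h1, sub_mul, one_mul, mul_add,
      mul_assoc _ (T n), mul_assoc _ (R n)]
    congr 1
    abel
  have hMdet : ∀ᶠ n in atTop, (M n).det ≠ 0 :=
    (((continuous_id.matrix_det).tendsto 1).comp hMlim).eventually_ne (by simp)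
  have hi : ∀ᶠ n in atTop, d n i = 1 := by
    filter_upwards [hγ] with n hn
    simp only [hd, hΛ]
    rw [← hn, inv_mul_cancel₀ (hγ0 n)]
  have hsol : ∃ z : ℕ → Fin 2 → ℂ, (∀ᶠ n in atTop, z (n + 1) = (M n).mulVec (z n)) ∧
      Tendsto z atTop (𝓝 (Pi.single i 1)) := by
    rcases hratio with h | ⟨c, hc, h⟩
    · refine exists_solution_of_subdominant hs hMdet
        ((tendsto_matrix_inv hMlim (by simp)).isBigO_one ℝ) hi ?_
      filter_upwards [h, hγ] with n hn hγn j
      rw [hd, norm_mul, norm_inv, ← div_eq_inv_mul, one_le_div (norm_pos_iff.2 (hγ0 n)), hγn]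
      exact hn j
    · refine exists_solution_of_dominant (q := fun n => c * p n) hs hi
        (fun n => mul_nonneg hc.le (hp0 n))
        (fun hsm => hpsum ((summable_mul_left_iff hc.ne').1 hsm)) ?_
      filter_upwards [h, hγ] with n hn hγn j hji
      rw [hd, norm_mul, norm_inv, ← div_eq_inv_mul, div_le_iff₀ (norm_pos_iff.2 (hγ0 n)), hγn]
      exact hn j hji
  refine exists_solution_of_eventually (A := fun n => (γ n)⁻¹ • A n) (fun n => ?_) ?_
  · rw [Matrix.det_smul]
    exact mul_ne_zero (pow_ne_zero _ (inv_ne_zero (hγ0 n))) (hA n)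
  obtain ⟨w, hw, hwlim⟩ := hsol
  refine ⟨fun n => (T n).mulVec ((μ i - μ i.rev)⁻¹ • w n), ?_, ?_⟩
  · filter_upwards [hw, hTdet] with n hn hdetn
    rw [hn, ← Matrix.mulVec_smul, Matrix.mulVec_mulVec, Matrix.mulVec_mulVec, hM,
      Matrix.mul_smul, ← mul_assoc, ← mul_assoc, Matrix.mul_nonsing_inv _ (Ne.isUnit hdetn),
      one_mul, smul_mul_assoc]
  · have hcont : Continuous fun q : Matrix (Fin 2) (Fin 2) ℂ × (Fin 2 → ℂ) => q.1.mulVec q.2 := by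
      fun_prop
    have h := (hcont.tendsto _).comp
      (hTlim.prodMk_nhds (hwlim.const_smul (μ i - μ i.rev)⁻¹))
    have e : T₀.mulVec ((μ i - μ i.rev)⁻¹ • Pi.single i 1) = x i := by
      rw [Matrix.mulVec_smul, Matrix.mulVec_single_one]
      ext k
      simp only [Pi.smul_apply, hT₀, hX, Matrix.col_apply, Matrix.mul_diagonal, smul_eq_mul,
        Matrix.transpose_apply, Matrix.of_apply]
      rw [mul_comm (x i k), inv_mul_cancel_left₀ (sub_ne_zero.2 (hμ' i))]
    simp only [e] at h
    exact h

end Diagonalisation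

/-! ### Eigenvalues of convergent sequences of real matrices -/

section Eigenvalues

open JanasMoszynski

theorem trace_toComplex (A : Matrix (Fin 2) (Fin 2) ℝ) : (toComplex A).trace = A.trace := by
  simp [toComplex, Matrix.trace_fin_two]

theorem det_toComplex (A : Matrix (Fin 2) (Fin 2) ℝ) : (toComplex A).det = A.det := by
  simp [toComplex, Matrix.det_fin_two]

section Norm

attribute [local instance] Matrix.linftyOpNormedAddCommGroup

theorem norm_toComplex_sub (A B : Matrix (Fin 2) (Fin 2) ℝ) :
    ‖toComplex A - toComplex B‖ = ‖A - B‖ := by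
  simp [Matrix.linfty_opNorm_def, toComplex, ← Complex.ofReal_sub, Complex.nnnorm_real]

end Norm

theorem areEigenvalues_iff {A : Matrix (Fin 2) (Fin 2) ℝ} {a : Fin 2 → ℂ} :
    AreEigenvalues A a ↔ a 0 + a 1 = A.trace ∧ a 0 * a 1 = A.det := by
  rw [AreEigenvalues, Matrix.charpoly_fin_two, trace_toComplex, det_toComplex]
  constructor
  · intro h
    have h0 := congrArg (eval 0) h
    have h1 := congrArg (eval 1) h
    simp at h0 h1
    exact ⟨by linear_combination h1 - h0, h0.symm⟩
  · rintro ⟨h0, h1⟩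
    rw [← h0, ← h1, C_add, C_mul]
    ring

theorem ne_of_areEigenvalues_of_discr_ne_zero {A : Matrix (Fin 2) (Fin 2) ℝ} {a : Fin 2 → ℂ}
    (h : AreEigenvalues A a) (hA : A.discr ≠ 0) : a 0 ≠ a 1 := by
  intro he
  obtain ⟨h0, h1⟩ := areEigenvalues_iff.1 h
  refine hA ?_
  rw [Matrix.discr_fin_two]
  have : ((A.trace ^ 2 - 4 * A.det : ℝ) : ℂ) = 0 := by
    push_cast
    rw [← h0, ← h1, he]
    ring
  exact_mod_cast this

theorem exists_areEigenvalues (A : Matrix (Fin 2) (Fin 2) ℝ) : ∃ a, AreEigenvalues A a := by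
  obtain ⟨s, hs⟩ := IsAlgClosed.exists_pow_nat_eq ((A.trace : ℂ) ^ 2 - 4 * A.det) zero_lt_two
  refine ⟨![(A.trace + s) / 2, (A.trace - s) / 2], areEigenvalues_iff.2 ⟨?_, ?_⟩⟩
  · simp only [Matrix.cons_val_zero, Matrix.cons_val_one]
    ring
  · simp only [Matrix.cons_val_zero, Matrix.cons_val_one]
    linear_combination -hs / 4

/-- Continuity of the eigenvalues: labelling first the eigenvalue of `V n` nearest to `μ 0`, its
distance to `μ 0` is at most the square root of the modulus of the characteristic polynomial of
`V n` at `μ 0`. -/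
theorem exists_tendsto_areEigenvalues {ι : Type*} {l : Filter ι}
    {V : ι → Matrix (Fin 2) (Fin 2) ℝ} {V₀ : Matrix (Fin 2) (Fin 2) ℝ} (hV : Tendsto V l (𝓝 V₀))
    {μ : Fin 2 → ℂ} (hμ : AreEigenvalues V₀ μ) :
    ∃ ν : ι → Fin 2 → ℂ, (∀ n, AreEigenvalues (V n) (ν n)) ∧
      ∀ i, Tendsto (fun n => ν n i) l (𝓝 (μ i)) := by
  have hex : ∀ n, ∃ a, AreEigenvalues (V n) a ∧ ‖a 0 - μ 0‖ ≤ ‖a 1 - μ 0‖ := by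
    intro n
    obtain ⟨a, ha⟩ := exists_areEigenvalues (V n)
    rcases le_total ‖a 0 - μ 0‖ ‖a 1 - μ 0‖ with h | h
    · exact ⟨a, ha, h⟩
    · refine ⟨![a 1, a 0], ?_, h⟩
      rw [areEigenvalues_iff] at ha ⊢
      simpa [add_comm, mul_comm] using ha
  choose ν hν hle using hex
  obtain ⟨h0, h1⟩ := areEigenvalues_iff.1 hμ
  have htr : Tendsto (fun n => ((V n).trace : ℂ)) l (𝓝 (V₀.trace : ℂ)) :=
    (Complex.continuous_ofReal.tendsto _).comp ((continuous_id.matrix_trace.tendsto V₀).comp hV)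
  have hdet : Tendsto (fun n => ((V n).det : ℂ)) l (𝓝 (V₀.det : ℂ)) :=
    (Complex.continuous_ofReal.tendsto _).comp ((continuous_id.matrix_det.tendsto V₀).comp hV)
  have hchar : Tendsto (fun n => √‖μ 0 ^ 2 - (V n).trace * μ 0 + (V n).det‖) l (𝓝 0) := by
    have h := (((htr.mul_const (μ 0)).const_sub (μ 0 ^ 2)).add hdet).norm.sqrt
    rw [← h0, ← h1] at h
    ring_nf at h ⊢
    simpa using h
  have hν0 : Tendsto (fun n => ν n 0) l (𝓝 (μ 0)) := by
    rw [tendsto_iff_norm_sub_tendsto_zero]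
    refine squeeze_zero (fun _ => norm_nonneg _) (fun n => ?_) hchar
    obtain ⟨h2, h3⟩ := areEigenvalues_iff.1 (hν n)
    refine Real.le_sqrt_of_sq_le ?_
    have e : μ 0 ^ 2 - (V n).trace * μ 0 + (V n).det = (ν n 0 - μ 0) * (ν n 1 - μ 0) := by
      rw [← h2, ← h3]
      ring
    rw [e, norm_mul, sq]
    gcongr
    exact hle n
  refine ⟨ν, hν, Fin.forall_fin_two.2 ⟨hν0, ?_⟩⟩
  have h := htr.sub hν0
  rw [← h0, add_sub_cancel_left] at h
  refine h.congr fun n => ?_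
  rw [← (areEigenvalues_iff.1 (hν n)).1, add_sub_cancel_left]

/-- A gap between the real parts of two sequences `a`, `b` makes `1 + p * b` dominate `1 + p * a`
by a factor `1 - c * p`. -/
theorem exists_norm_one_add_mul_le {p : ℕ → ℝ} (hp0 : ∀ n, 0 ≤ p n)
    (hp : Tendsto p atTop (𝓝 0)) {a b : ℕ → ℂ} {α β : ℂ} (ha : Tendsto a atTop (𝓝 α))
    (hb : Tendsto b atTop (𝓝 β)) (h : α.re < β.re) :
    ∃ c > 0, ∀ᶠ n in atTop, ‖1 + p n * a n‖ ≤ (1 - c * p n) * ‖1 + p n * b n‖ := by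
  obtain ⟨c, hc⟩ : ∃ c, c = (β.re - α.re) / 2 := ⟨_, rfl⟩
  have hc0 : 0 < c := by linarith
  have har := (Complex.continuous_re.tendsto α).comp ha
  have hbr := (Complex.continuous_re.tendsto β).comp hb
  -- the coefficient of `p` in `(1 - 2 c p) ‖1 + p b‖² - ‖1 + p a‖²`
  have hlim : Tendsto (fun n => 2 * ((b n).re - (a n).re) - 2 * c - 4 * c * (p n * (b n).re)
      + p n * ‖b n‖ ^ 2 - 2 * c * (p n * (p n * ‖b n‖ ^ 2)) - p n * ‖a n‖ ^ 2) atTop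
      (𝓝 (2 * (β.re - α.re) - 2 * c - 4 * c * (0 * β.re) + 0 * ‖β‖ ^ 2
        - 2 * c * (0 * (0 * ‖β‖ ^ 2)) - 0 * ‖α‖ ^ 2)) :=
    ((((((hbr.sub har).const_mul 2).sub_const (2 * c)).sub ((hp.mul hbr).const_mul (4 * c))).add
      (hp.mul (hb.norm.pow 2))).sub ((hp.mul (hp.mul (hb.norm.pow 2))).const_mul (2 * c))).sub
      (hp.mul (ha.norm.pow 2))
  have hcp : Tendsto (fun n => c * p n) atTop (𝓝 0) := by simpa using hp.const_mul c
  have hsq : ∀ (r : ℝ) (w : ℂ), ‖1 + r * w‖ ^ 2 = 1 + 2 * (r * w.re) + r ^ 2 * ‖w‖ ^ 2 := by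
    intro r w
    rw [← Complex.normSq_eq_norm_sq, ← Complex.normSq_eq_norm_sq, Complex.normSq_apply,
      Complex.normSq_apply]
    simp
    ring
  refine ⟨c, hc0, ?_⟩
  filter_upwards [hlim.eventually_const_lt (u := 0) (by linarith),
    hcp.eventually_lt_const zero_lt_one] with n hn hn1
  refine le_of_sq_le_sq ?_ (mul_nonneg (by linarith) (norm_nonneg _))
  rw [mul_pow, hsq]
  calc 1 + 2 * (p n * (a n).re) + p n ^ 2 * ‖a n‖ ^ 2
      ≤ (1 - 2 * (c * p n)) * ‖1 + p n * b n‖ ^ 2 := by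
        rw [hsq]
        nlinarith [mul_nonneg (hp0 n) hn.le]
    _ ≤ (1 - c * p n) ^ 2 * ‖1 + p n * b n‖ ^ 2 := by
        gcongr
        nlinarith [sq_nonneg (c * p n)]

/-- If the limits of the two eigenvalues of real matrices are distinct with equal real parts, the
eigenvalues are eventually complex conjugate. -/
theorem eventually_eq_conj {V : ℕ → Matrix (Fin 2) (Fin 2) ℝ} {ν : ℕ → Fin 2 → ℂ} {μ : Fin 2 → ℂ}
    (hν : ∀ n, AreEigenvalues (V n) (ν n)) (hlim : ∀ i, Tendsto (fun n => ν n i) atTop (𝓝 (μ i)))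
    (hμ : μ 0 ≠ μ 1) (hre : (μ 0).re = (μ 1).re) :
    ∀ᶠ n in atTop, ν n 1 = starRingEnd ℂ (ν n 0) := by
  have him : ∀ i, Tendsto (fun n => (ν n i).im) atTop (𝓝 (μ i).im) := fun i =>
    (Complex.continuous_im.tendsto _).comp (hlim i)
  have hsum : ∀ n, (ν n 0).im + (ν n 1).im = 0 := fun n => by
    simpa using congrArg Complex.im (areEigenvalues_iff.1 (hν n)).1
  have hμsum : (μ 0).im + (μ 1).im = 0 := by
    refine tendsto_nhds_unique ((him 0).add (him 1)) ?_
    simp only [hsum]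
    exact tendsto_const_nhds
  have hμ0 : (μ 0).im ≠ 0 := fun h => hμ (Complex.ext hre (by linarith))
  filter_upwards [(him 0).eventually_ne hμ0] with n hn
  have h := congrArg Complex.im (areEigenvalues_iff.1 (hν n)).2
  simp only [Complex.mul_im, Complex.ofReal_im] at h
  have h1 : (ν n 1).im = -(ν n 0).im := by linarith [hsum n]
  refine Complex.ext ?_ (by simpa using h1)
  rw [h1] at h
  refine mul_left_cancel₀ hn ?_
  rw [Complex.conj_re]
  linarith

/-- The dichotomy behind the theorem: eigenvalues of real matrices have limits which differ in their
real parts, or they are complex conjugate, so that the two diagonal entries have equal moduli. -/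
theorem norm_one_add_mul_dichotomy {p : ℕ → ℝ} (hp0 : ∀ n, 0 ≤ p n)
    (hp : Tendsto p atTop (𝓝 0)) {V : ℕ → Matrix (Fin 2) (Fin 2) ℝ} {ν : ℕ → Fin 2 → ℂ}
    {μ : Fin 2 → ℂ} (hν : ∀ n, AreEigenvalues (V n) (ν n))
    (hlim : ∀ i, Tendsto (fun n => ν n i) atTop (𝓝 (μ i)))
    (hμ : μ 0 ≠ μ 1) (hre : (μ 0).re ≤ (μ 1).re) (i : Fin 2) :
    (∀ᶠ n in atTop, ∀ j, ‖1 + p n * ν n i‖ ≤ ‖1 + p n * ν n j‖) ∨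
      ∃ c > 0, ∀ᶠ n in atTop, ∀ j ≠ i,
        ‖1 + p n * ν n j‖ ≤ (1 - c * p n) * ‖1 + p n * ν n i‖ := by
  rcases hre.eq_or_lt with h | h
  · left
    filter_upwards [eventually_eq_conj hν hlim hμ h] with n hn
    have e : ‖1 + p n * ν n 1‖ = ‖1 + p n * ν n 0‖ := by
      rw [← Complex.norm_conj (1 + p n * ν n 0), hn]
      simp
    intro j
    fin_cases i <;> fin_cases j <;> simp [e]
  · obtain ⟨c, hc, hle⟩ := exists_norm_one_add_mul_le hp0 hp (hlim 0) (hlim 1) h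
    fin_cases i
    · left
      filter_upwards [hle] with n hn
      refine Fin.forall_fin_two.2 ⟨le_rfl, hn.trans ?_⟩
      exact mul_le_of_le_one_left (norm_nonneg _) (by nlinarith [mul_nonneg hc.le (hp0 n)])
    · right
      refine ⟨c, hc, ?_⟩
      filter_upwards [hle] with n hn
      refine Fin.forall_fin_two.2 ⟨fun _ => hn, fun h => absurd rfl h⟩

end Eigenvalues

/-! ### The solution space and reindexing from `ℕ+` to `ℕ` -/

section Solutions

open JanasMoszynski

theorem prod_Icc_one_pnat {M : Type*} [CommMonoid M] (f : ℕ+ → M) (n : ℕ+) :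
    ∏ k ∈ Finset.Icc 1 n, f k = ∏ k ∈ Finset.range n, f k.succPNat := by
  refine Finset.prod_nbij' PNat.natPred Nat.succPNat ?_ ?_ ?_ ?_ ?_
  · intro k hk
    have := PNat.coe_le_coe _ _ |>.2 (Finset.mem_Icc.1 hk).2
    have := k.pos
    simp only [Finset.mem_range, PNat.natPred]
    omega
  · intro k hk
    rw [Finset.mem_range] at hk
    refine Finset.mem_Icc.2 ⟨one_le, ?_⟩
    rw [← PNat.coe_le_coe, Nat.succPNat_coe]
    omega
  · simp
  · simp
  · simp

theorem nonzeroProd_eq (a : ℕ+ → ℂ) (n : ℕ+) :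
    nonzeroProd a n =
      ∏ k ∈ Finset.range n, if a k.succPNat = 0 then 1 else a k.succPNat := by
  rw [nonzeroProd, Finset.prod_filter, prod_Icc_one_pnat]
  simp only [ne_eq, ite_not]

theorem solution_apply_one_injective (A : ℕ+ → Matrix (Fin 2) (Fin 2) ℂ) :
    Function.Injective ((LinearMap.proj (R := ℂ) (φ := fun _ : ℕ+ => Fin 2 → ℂ) 1).comp
      (solutionSpace A).subtype) := by
  intro u v h
  refine Subtype.ext (funext fun n => ?_)
  induction n with
  | one => exact h
  | succ n ih => rw [u.2 n, v.2 n, ih]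

/-- Two solutions whose values at one index are linearly independent form a basis of the solution
space, as a solution is determined by its value at `1`. -/
theorem exists_basis_of_det_ne_zero {A : ℕ+ → Matrix (Fin 2) (Fin 2) ℂ}
    (u : Fin 2 → solutionSpace A) (n : ℕ+)
    (h : (Matrix.of fun i => (u i : ℕ+ → Fin 2 → ℂ) n).det ≠ 0) :
    ∃ b : Module.Basis (Fin 2) ℂ (solutionSpace A), ⇑b = u := by
  have hinj := solution_apply_one_injective A
  have hfin : FiniteDimensional ℂ (solutionSpace A) := Module.Finite.of_injective _ hinj
  have hli : LinearIndependent ℂ u := by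
    refine LinearIndependent.of_comp ((LinearMap.proj (R := ℂ)
      (φ := fun _ : ℕ+ => Fin 2 → ℂ) n).comp (solutionSpace A).subtype) ?_
    exact Matrix.linearIndependent_rows_iff_isUnit.2
      ((Matrix.isUnit_iff_isUnit_det _).2 (Ne.isUnit h))
  have hcard : Fintype.card (Fin 2) = Module.finrank ℂ (solutionSpace A) := by
    refine le_antisymm hli.fintype_card_le_finrank ?_
    simpa using LinearMap.finrank_le_finrank_of_injective hinj
  exact ⟨basisOfLinearIndependentOfCardEqFinrank hli hcard, by simp⟩

theorem tendsto_succPNat_atTop : Tendsto Nat.succPNat atTop atTop :=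
  OrderIso.pnatIsoNat.symm.tendsto_atTop

theorem tendsto_natPred_atTop : Tendsto PNat.natPred atTop atTop :=
  OrderIso.pnatIsoNat.tendsto_atTop

theorem natPred_succ_eq (n : ℕ+) : (n + 1).natPred = n.natPred + 1 := by
  have := n.pos
  simp only [PNat.natPred, PNat.add_coe, PNat.one_coe]
  omega

/-- Rescaling a solution `z` of the normalized system by the products of the normalizing factors
gives a solution of the original system. -/
theorem exists_solution_of_normalized {A : ℕ+ → Matrix (Fin 2) (Fin 2) ℂ} {γ : ℕ → ℂ}
    (hγ : ∀ n, γ n ≠ 0) {z : ℕ → Fin 2 → ℂ}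
    (hz : ∀ n, z (n + 1) = ((γ n)⁻¹ • A n.succPNat).mulVec (z n)) :
    (fun n : ℕ+ => (∏ k ∈ Finset.range n.natPred, γ k) • z n.natPred) ∈ solutionSpace A := by
  intro n
  simp only
  rw [natPred_succ_eq, Finset.prod_range_succ, hz, PNat.succPNat_natPred, Matrix.smul_mulVec,
    Matrix.mulVec_smul, smul_smul, mul_assoc, mul_inv_cancel₀ (hγ _), mul_one]

end Solutions

/-! ### The asymptotics of a basis of solutions -/

theorem mainTheorem2
    (p : ℕ+ → ℝ) (V : ℕ+ → Matrix (Fin 2) (Fin 2) ℝ) (R : ℕ+ → Matrix (Fin 2) (Fin 2) ℂ)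
    (hp_pos : ∀ n, 0 < p n)
    (hp_lim : Tendsto p atTop (𝓝 0))
    (hp_sum : Tendsto (fun n : ℕ+ => ∑ k ∈ Finset.Icc 1 n, p k) atTop atTop)
    (hR : JanasMoszynski.IsL1 R)
    (hV : JanasMoszynski.IsD1 V)
    (Vlim : Matrix (Fin 2) (Fin 2) ℝ) (hVlim : Tendsto V atTop (𝓝 Vlim))
    (hdiscr : Vlim.discr ≠ 0)
    (hdet : ∀ n, (JanasMoszynski.coeff p V R n).det ≠ 0)
    (μ : Fin 2 → ℂ) (hμ : JanasMoszynski.AreEigenvalues Vlim μ) (hμ_re : (μ 0).re ≤ (μ 1).re)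
    (x : Fin 2 → Fin 2 → ℂ)
    (hx : ∀ i, Module.End.HasEigenvector
      (Matrix.toLin' (JanasMoszynski.toComplex Vlim)) (μ i) (x i)) :
    -- the eigenvalues of `V n` can be labelled so that they converge to those of the limit
    (∃ ν : ℕ+ → Fin 2 → ℂ, (∀ n, JanasMoszynski.AreEigenvalues (V n) (ν n)) ∧
      ∀ i, Tendsto (fun n => ν n i) atTop (𝓝 (μ i))) ∧
    -- and for every such labelling the asymptotics hold
    ∀ ν : ℕ+ → Fin 2 → ℂ, (∀ n, JanasMoszynski.AreEigenvalues (V n) (ν n)) →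
      (∀ i, Tendsto (fun n => ν n i) atTop (𝓝 (μ i))) →
      ∃ u : Module.Basis (Fin 2) ℂ
          (JanasMoszynski.solutionSpace (JanasMoszynski.coeff p V R)),
        ∀ i, ∃ ε : ℕ+ → Fin 2 → ℂ, Tendsto ε atTop (𝓝 0) ∧
          ∀ n, (u i : ℕ+ → Fin 2 → ℂ) n =
            JanasMoszynski.nonzeroProd (fun k => 1 + (p k : ℂ) * ν k i) n • (x i + ε n) := by
  open JanasMoszynski in
  refine ⟨exists_tendsto_areEigenvalues hVlim hμ, fun ν hν hνlim => ?_⟩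
  have hμne : μ 0 ≠ μ 1 := ne_of_areEigenvalues_of_discr_ne_zero hμ hdiscr
  have hp' : Tendsto (fun n : ℕ => p n.succPNat) atTop (𝓝 0) := hp_lim.comp tendsto_succPNat_atTop
  have hνlim' : ∀ i, Tendsto (fun n : ℕ => ν n.succPNat i) atTop (𝓝 (μ i)) := fun i =>
    (hνlim i).comp tendsto_succPNat_atTop
  have hpsum : ¬ Summable fun n : ℕ => p n.succPNat := by
    rw [not_summable_iff_tendsto_nat_atTop_of_nonneg fun n => (hp_pos _).le]
    refine (tendsto_add_atTop_iff_nat 1).1 ((hp_sum.comp tendsto_succPNat_atTop).congr fun n => ?_)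
    exact congrArg Multiplicative.toAdd
      (prod_Icc_one_pnat (fun k => Multiplicative.ofAdd (p k)) n.succPNat)
  have hVlim' : Tendsto (fun n : ℕ => toComplex (V n.succPNat)) atTop (𝓝 (toComplex Vlim)) := by
    have hc : Continuous toComplex := continuous_id.matrix_map Complex.continuous_ofReal
    exact (hc.tendsto _).comp (hVlim.comp tendsto_succPNat_atTop)
  -- the factors of the product, with vanishing ones replaced by `1`
  let γ : Fin 2 → ℕ → ℂ := fun i k =>
    if 1 + (p k.succPNat : ℂ) * ν k.succPNat i = 0 then 1
    else 1 + (p k.succPNat : ℂ) * ν k.succPNat i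
  have hγ0 : ∀ i k, γ i k ≠ 0 := by
    intro i k
    simp only [γ]
    split_ifs with h
    · exact one_ne_zero
    · exact h
  have hfac : ∀ i, Tendsto (fun n : ℕ => 1 + (p n.succPNat : ℂ) * ν n.succPNat i) atTop (𝓝 1) := by
    intro i
    have h := ((Complex.continuous_ofReal.tendsto 0).comp hp').mul (hνlim' i)
    simpa using h.const_add 1
  have hγ : ∀ i, ∀ᶠ n in atTop, γ i n = 1 + (p n.succPNat : ℂ) * ν n.succPNat i := by
    intro i
    filter_upwards [(hfac i).eventually_ne one_ne_zero] with n hn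
    exact if_neg hn
  have hz : ∀ i, ∃ z : ℕ → Fin 2 → ℂ,
      (∀ n, z (n + 1) = ((γ i n)⁻¹ • coeff p V R n.succPNat).mulVec (z n)) ∧
      Tendsto z atTop (𝓝 (x i)) := by
    intro i
    refine exists_normalized_solution (p := fun n => p n.succPNat)
      (V := fun n => toComplex (V n.succPNat)) (R := fun n => R n.succPNat)
      (ν := fun n => ν n.succPNat) (fun n => (hp_pos _).le) hp' hpsum
      (hR.comp_injective Nat.succPNat_injective) hVlim' ?_ ?_ ?_
      (tendsto_pi_nhds.2 hνlim') hμne hx (fun n => hdet _) (hγ0 i) (hγ i)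
      (norm_one_add_mul_dichotomy (fun n => (hp_pos _).le) hp' (fun n => hν _) hνlim' hμne hμ_re i)
    · refine (hV.comp_injective Nat.succPNat_injective).congr fun n => ?_
      exact (norm_toComplex_sub _ _).symm
    · intro n j
      rw [trace_toComplex, ← (areEigenvalues_iff.1 (hν _)).1]
      fin_cases j
      · rfl
      · exact add_comm _ _
    · intro n j
      rw [det_toComplex, ← (areEigenvalues_iff.1 (hν _)).2]
      fin_cases j
      · rfl
      · exact mul_comm _ _
  choose z hzrec hzlim using hz
  let u : Fin 2 → solutionSpace (coeff p V R) := fun i =>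
    ⟨_, exists_solution_of_normalized (hγ0 i) (hzrec i)⟩
  have hdetlim : Tendsto (fun n => (Matrix.of fun i => z i n).det) atTop
      (𝓝 (Matrix.of x).det) := by
    simp only [Matrix.det_fin_two, Matrix.of_apply]
    have h := fun i => tendsto_pi_nhds.1 (hzlim i)
    exact ((h 0 0).mul (h 1 1)).sub ((h 0 1).mul (h 1 0))
  -- independence is tested at a late index, where the normalized solutions are close to the `x i`
  obtain ⟨n, hn⟩ := (hdetlim.eventually_ne (det_of_eigenvectors_ne_zero hμne hx)).exists
  obtain ⟨b, hb⟩ := exists_basis_of_det_ne_zero u n.succPNat (by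
    have hc : ∀ i, ∏ k ∈ Finset.range n, γ i k ≠ 0 := fun i =>
      Finset.prod_ne_zero_iff.2 fun k _ => hγ0 i k
    have h := mul_ne_zero (mul_ne_zero (hc 0) (hc 1)) hn
    convert h using 1
    simp only [Matrix.det_fin_two, Matrix.of_apply, u, Nat.natPred_succPNat, Pi.smul_apply,
      smul_eq_mul]
    ring)
  refine ⟨b, fun i => ⟨fun n => (γ i n.natPred)⁻¹ • z i n.natPred - x i, ?_, fun n => ?_⟩⟩
  · have hγinv : Tendsto (fun n => (γ i n)⁻¹) atTop (𝓝 1) := by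
      simpa using ((hfac i).congr' ((hγ i).mono fun n hn => hn.symm)).inv₀ one_ne_zero
    have h := ((hγinv.smul (hzlim i)).sub_const (x i)).comp tendsto_natPred_atTop
    simpa [Function.comp_def] using h
  · -- the product up to `n` has one factor more than the normalization of `u i`
    rw [hb, nonzeroProd_eq, ← PNat.natPred_add_one n, Finset.prod_range_succ,
      add_sub_cancel, smul_smul, mul_assoc]
    change _ = (_ * (γ i n.natPred * _)) • _
    rw [mul_inv_cancel₀ (hγ0 i _), mul_one]
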